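/- A *Grothendieck category* is a cocomplete abelian category with a generator in which directed colimits are exact. An object is *Noetherian* if it satisfies the ascending chain condition on subobjects. A ring $R$ is *directly finite* if $xy=1$ implies $yx=1$ for all $x,y\in R$. For a category $\mathcal G$ and a group $G$, let $\mathcal G^G:=\mathrm{Fun}(G,\mathcal G)$ be the category of functors to $\mathcal G$ from $G$ viewed as a category with one object. Its objects are the pairs $(X,\lambda)$ of an object $X$ of $\mathcal G$ and a homomorphism $\lambda\colon G\to\mathrm{Aut}_{\mathcal G}(X)$, and its morphisms are the $G$-equivariant morphisms. When $\mathcal G$ is a Grothendieck category, $\uparrow_{\mathbf 1}^G\colon\mathcal G\to\mathcal G^G$ denotes the left adjoint of the forgetful functor $\mathcal G^G\to\mathcal G$, $(X,\lambda)\mapsto X$. Explicitly, $\uparrow_{\mathbf 1}^G X$ is the coproduct $X^{(G)}$ of copies of $X$ indexed by $G$, on which $g\in G$ maps the copy of index $h$ identically onto the copy of index $gh$. Let $B$ be a set. A *$B$-labeled digraph* $\Gamma=(V,E)$ consists of a set $V$ of vertices, a set $E\subseteq V\times V$ of edges and a map $E\to B$ (the labeling). For $v\in V$ and $r\in\mathbb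 N$, the $r$-neighborhood $N_r(v)$ is the set of the vertices that can be reached from $v$ by a directed path with at most $r$ edges; it is regarded as a $B$-labeled digraph, with all the edges of $\Gamma$ between its vertices and their labels. Isomorphisms of $B$-labeled digraphs are the bijections between the vertex sets that preserve and reflect edges and preserve labels. For a group $G$ and a subset $B\subseteq G$, the *Cayley graph* $\Gamma(G,B)$ is the $B$-labeled digraph with vertex set $G$ and with an edge $(g,gb)$, labeled by $b$, for all $g\in G$ and $b\in B$; the $r$-neighborhood of $1$ in $\Gamma(G,B)$ is denoted by $N_r(B)$. A finitely generated group $G$ is *sofic* if for each finite symmetric set $B$ of generators of $G$, each $\varepsilon\in(0,1)$ and each $r\in\mathbb N$, there are a finite $B$-labeled digraph $\Gamma=(V,E)$ with $V\neq\emptyset$ and a subset $V_0\subseteq V$ such that $|V_0|\ge(1-\varepsilon)|V|$ and, for each $v\in V_0$, the $r$-neighborhood $N_r(v)$ of $v$ in $\Gamma$ is isomorphic to $N_r(B)$ as a $B$-labeled digraph. **Corollary.** Let $\mathcal G$ be a Grothendieck category, $G$ a finitely generated sofic group and $N\in\mathcal G$ a Noetherian object. Then the endomorphism ring $\mathrm{End}_{\mathcal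 G^G}(\uparrow_{\mathbf 1}^G N)$ is directly finite. -/

import Mathlib

open CategoryTheory CategoryTheory.Limits

universe w v u

/-! ### Labeled digraphs and sofic groups -/

/-- A `B`-labeled directed graph with vertex set `V`: a set of ordered pairs of vertices (the edges)
together with a map from the edges to the set of labels. -/
structure LabeledDigraph (B : Type*) (V : Type*) where
  /-- the set of edges -/
  edge : Set (V × V)
  /-- the label of an edge -/
  label : edge → B

namespace LabeledDigraph

variable {B V V₁ V₂ : Type*}

/-- The labeled digraph that a set of vertices inherits: all the edges between its vertices, with
the same labels. -/
def induce (Γ : LabeledDigraph B V) (s : Set V) : LabeledDigraph B s where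
  edge := {e | ((e.1 : V), (e.2 : V)) ∈ Γ.edge}
  label e := Γ.label ⟨((e.1.1 : V), (e.1.2 : V)), e.2⟩

/-- An isomorphism of `B`-labeled digraphs: a bijection between the sets of vertices that preserves
and reflects the edges and respects the labels. -/
structure Iso (Γ₁ : LabeledDigraph B V₁) (Γ₂ : LabeledDigraph B V₂) extends V₁ ≃ V₂ where
  edge_iff : ∀ x y : V₁, (x, y) ∈ Γ₁.edge ↔ (toEquiv x, toEquiv y) ∈ Γ₂.edge
  label_eq : ∀ (x y : V₁) (h : (x, y) ∈ Γ₁.edge),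
    Γ₁.label ⟨(x, y), h⟩ = Γ₂.label ⟨(toEquiv x, toEquiv y), (edge_iff x y).1 h⟩

/-- `Γ.HasPath n x y`: there is a directed path from `x` to `y` with exactly `n` edges. -/
def HasPath (Γ : LabeledDigraph B V) : ℕ → V → V → Prop
  | 0, x, y => x = y
  | n + 1, x, y => ∃ z, (x, z) ∈ Γ.edge ∧ Γ.HasPath n z y

/-- The number of edges in a shortest directed path from `x` to `y`, and `⊤` if there is no such
path. -/
noncomputable def dist (Γ : LabeledDigraph B V) (x y : V) : ℕ∞ :=
  ⨅ (n : ℕ) (_ : Γ.HasPath n x y), (n : ℕ∞)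

/-- The `r`-th neighborhood of the vertex `x`. -/
def nbhd (Γ : LabeledDigraph B V) (r : ℕ) (x : V) : Set V :=
  {y | Γ.dist x y ≤ r}

/-- The Cayley graph of `G` with respect to `B`: the vertices are the elements of `G`, the edges
are the pairs `(g, g * b)` with `b ∈ B`, and such an edge is labeled by `b`. -/
def cayley {G : Type*} [Group G] (B : Set G) : LabeledDigraph B G where
  edge := {e | e.1⁻¹ * e.2 ∈ B}
  label e := ⟨e.1.1⁻¹ * e.1.2, e.2⟩

end LabeledDigraph

/-- Soficity of a finitely generated group `G`: for all finite symmetric sets of generators `B` of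
`G`, all `ε ∈ (0, 1)` and all `r`, there is a finite non-empty `B`-labeled digraph in which all
vertices, up to a proportion of at most `ε`, have an `r`-neighborhood isomorphic to the
`r`-neighborhood of `1` in the Cayley graph of `G` with respect to `B`.
(This is only meant for finitely generated groups: otherwise there is no such `B`.) -/
def IsSoficOfFG (G : Type*) [Group G] : Prop :=
  ∀ B : Set G, B.Finite → (∀ b ∈ B, b⁻¹ ∈ B) → Subgroup.closure B = ⊤ →
    ∀ ε : ℝ, 0 < ε → ε < 1 → ∀ r : ℕ,
      ∃ (V : Type) (_ : Fintype V) (_ : Nonempty V) (Γ : LabeledDigraph B V) (V₀ : Finset V),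
        (1 - ε) * (Fintype.card V : ℝ) ≤ (V₀.card : ℝ) ∧
        ∀ x ∈ V₀, Nonempty (LabeledDigraph.Iso (Γ.induce (Γ.nbhd r x))
          ((LabeledDigraph.cayley B).induce ((LabeledDigraph.cayley B).nbhd r 1)))

/-! ### Representations of a group on the objects of a category -/

/-- The category of representations of the group `G` on the category `𝒢`: functors to `𝒢` from
`G`, viewed as a category with one object. -/
abbrev RepCat (G : Type*) [Group G] (𝒢 : Type*) [Category* 𝒢] :=
  SingleObj G ⥤ 𝒢

/-- The restriction (forgetful) functor, along the inclusion of the trivial group in `G`: it maps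
a representation to its underlying object. -/
abbrev restrictTrivial (G : Type*) [Group G] (𝒢 : Type*) [Category* 𝒢] : RepCat G 𝒢 ⥤ 𝒢 :=
  (evaluation (SingleObj G) 𝒢).obj (SingleObj.star G)

/-- A Grothendieck category has coproducts indexed by the elements of a group `G`, here seen as the
set of endomorphisms of the only object of `SingleObj G`. -/
theorem hasCoproductsOfShape_singleObj_hom (G : Type w) [Group G] (𝒢 : Type u) [Category.{v} 𝒢]
    [Abelian 𝒢] [IsGrothendieckAbelian.{w} 𝒢] (a b : SingleObj G) :
    HasCoproductsOfShape (a ⟶ b) 𝒢 :=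
  inferInstanceAs (HasColimitsOfShape (Discrete G) 𝒢)

/-- The extension functor, from the trivial group to `G`. It maps `X` to the coproduct of copies of
`X` indexed by `G`, on which `g` acts by mapping the copy of index `h` identically onto the copy of
index `g * h`; it is left adjoint to the restriction functor, see `extendTrivialAdj`. -/
noncomputable def extendTrivial (G : Type w) [Group G] (𝒢 : Type u) [Category.{v} 𝒢]
    [Abelian 𝒢] [IsGrothendieckAbelian.{w} 𝒢] : 𝒢 ⥤ RepCat G 𝒢 :=
  haveI := hasCoproductsOfShape_singleObj_hom G 𝒢
  evaluationLeftAdjoint 𝒢 (SingleObj.star G)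

/-- The extension functor is left adjoint to the restriction functor. -/
noncomputable def extendTrivialAdj (G : Type w) [Group G] (𝒢 : Type u) [Category.{v} 𝒢]
    [Abelian 𝒢] [IsGrothendieckAbelian.{w} 𝒢] :
    extendTrivial.{w} G 𝒢 ⊣ restrictTrivial G 𝒢 :=
  haveI := hasCoproductsOfShape_singleObj_hom G 𝒢
  evaluationAdjunctionRight 𝒢 (SingleObj.star G)

/-! An equivariant endomorphism of the coproduct of the copies of `N` is determined by its
restriction to the copy of index 1. As `N` is Noetherian, that restriction has only finitely many
nonzero components, so the endomorphism ring embeds anti-multiplicatively in the group ring of `G`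
over `(End N)ᵐᵒᵖ` (`exists_monoidAlgebra_of_extendTrivial`). It remains to see that this group ring
is directly finite.

For coefficients `Module.End D H` with `H` of finite length, length replaces dimension in a counting
argument. If `x * y = 1` and `y * x ≠ 1`, let `x` and `y` act on `V → H` for a finite digraph `V`
that looks like `G` around most vertices. The image of `y` is almost as long as `V → H`, since `x`
inverts `y` on the left at good vertices. Yet the quotient by it has length at least one for each of
a family of disjoint balls, whose number is a fixed proportion of the good vertices
(`LabeledDigraph.card_mul_length_add_card_le`). For small `ε` the two estimates are incompatible.

The passage from `N` to finite length uses Hom into injective objects. For `E` injective, `X ↦ (X ⟶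
E)` is exact, so its length over `End E` is additive. If `e = 1 - y * x` is nonzero, it is
idempotent, and `exists_subobject_homLength_ne_top_comp_ne_zero` gives a fully invariant `A ≤ N` and
an injective `E` such that `A ⟶ E` has finite length and some coefficient of `e` acts on it
nontrivially. The finite length case, applied to the image of the group ring over `Module.End (End
E) (A ⟶ E)`, kills `e` there, a contradiction. -/

/-! ### Directed suprema of subobjects. -/

section Grothendieck

variable {𝒢 : Type u} [Category.{v} 𝒢] [Abelian 𝒢] [IsGrothendieckAbelian.{w} 𝒢]

attribute [local instance] IsFiltered.isConnected

/-- In a Grothendieck category, a morphism from the supremum of a directed family of subobjects is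
a monomorphism if its restrictions to the members of the family are. -/
theorem mono_of_isLUB {X Z : 𝒢} {c : Set (Subobject X)} (hne : c.Nonempty)
    (hc : DirectedOn (· ≤ ·) c) {s : Subobject X} (hs : IsLUB c s) (f : (s : 𝒢) ⟶ Z)
    (hf : ∀ U (hU : U ∈ c), Mono (Subobject.ofLE U s (hs.1 hU) ≫ f)) : Mono f := by
  have : Small.{w} c := small_of_injective Subtype.val_injective
  obtain ⟨J, ⟨e'⟩⟩ := Small.equiv_small.{w} (α := c)
  let e : J → c := e'.symm
  let _ : Preorder J := Preorder.lift e
  have : Nonempty J := ⟨e' ⟨_, hne.some_mem⟩⟩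
  have : IsDirectedOrder J := ⟨fun a b => by
    obtain ⟨d, hd, h₁, h₂⟩ := hc _ (e a).2 _ (e b).2
    refine ⟨e' ⟨d, hd⟩, ?_, ?_⟩
    · change (e a).1 ≤ (e _).1
      simpa [e] using h₁
    · change (e b).1 ≤ (e _).1
      simpa [e] using h₂⟩
  have hmono : Monotone fun j : J => (e j).1 := fun a b h => h
  let F : J ⥤ MonoOver X := hmono.functor ⋙ Subobject.representative
  have hmk (j : J) : Subobject.mk (F.obj j).obj.hom = (e j).1 := Subobject.mk_arrow _
  have hle (j : J) : (e j).1 ≤ s := hs.1 (e j).2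
  have harrow (j : J) : Subobject.ofLE _ _ (hle j) ≫ s.arrow = (F.obj j).obj.hom :=
    Subobject.ofLE_arrow (hle j)
  have hw {j j' : J} (a : j ⟶ j') :
      ((F ⋙ MonoOver.forget X).map a).left ≫ (F.obj j').obj.hom = (F.obj j).obj.hom :=
    Over.w ((F ⋙ MonoOver.forget X).map a)
  have hw' {j j' : J} (a : j ⟶ j') : ((F ⋙ MonoOver.forget X).map a).left ≫
      Subobject.ofLE _ _ (hle j') = Subobject.ofLE _ _ (hle j) :=
    (cancel_mono s.arrow).1 ((Category.assoc _ _ _).trans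
      ((congrArg _ (harrow j')).trans ((hw a).trans (harrow j).symm)))
  let k : Cocone (F ⋙ MonoOver.forget X) :=
    { pt := Over.mk s.arrow
      ι :=
        { app := fun j => Over.homMk (Subobject.ofLE _ _ (hle j)) (Subobject.ofLE_arrow _)
          naturality := fun j j' a => by
            ext
            exact (hw' a).trans (Category.comp_id _).symm } }
  have : Mono k.pt.hom := inferInstanceAs (Mono s.arrow)
  have hk : Subobject.mk k.pt.hom = ⨆ j, Subobject.mk (F.obj j).obj.hom := by
    change Subobject.mk s.arrow = _
    rw [Subobject.mk_arrow]
    simp only [hmk]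
    refine hs.unique ⟨?_, ?_⟩
    · intro U hU
      simpa [e] using le_iSup (fun j => (e j).1) (e' ⟨U, hU⟩)
    · intro U hU
      exact iSup_le fun j => hU (e j).2
  -- Exactness enters here: `s` is the colimit of the directed family, and `f` is the filtered
  -- colimit of monomorphisms to the constant diagram at `Z`.
  have hcolim := IsGrothendieckAbelian.isColimitMapCoconeOfSubobjectMkEqISup F k hk
  let α : (F ⋙ MonoOver.forget X) ⋙ Over.forget X ⟶ (Functor.const J).obj Z :=
    { app := fun j => Subobject.ofLE _ _ (hle j) ≫ f
      naturality := fun j j' a => by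
        refine (Category.assoc _ _ _).symm.trans ?_
        exact (congrArg (· ≫ f) (hw' a)).trans (Category.comp_id _).symm }
  have (j : J) : Mono (α.app j) := hf _ (e j).2
  have := NatTrans.mono_of_mono_app α
  exact colim.map_mono' α hcolim (isColimitConstCocone J Z) f fun j => (Category.comp_id _).symm

/-- In a Grothendieck category, a morphism whose restrictions to the members of a directed family
of subobjects are monomorphisms restricts to a monomorphism on the supremum of the family. -/
theorem mono_arrow_comp_of_isLUB {X Z : 𝒢} {c : Set (Subobject X)} (hne : c.Nonempty)
    (hc : DirectedOn (· ≤ ·) c) {s : Subobject X} (hs : IsLUB c s) (f : X ⟶ Z)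
    (hf : ∀ U ∈ c, Mono (U.arrow ≫ f)) : Mono (s.arrow ≫ f) :=
  mono_of_isLUB hne hc hs _ fun U hU => by simpa using hf U hU

end Grothendieck

/-! ### Essential morphisms and injective hulls. -/

section Essential

variable {𝒢 : Type u} [Category.{v} 𝒢]

/-- A morphism is essential if a morphism out of its target is a monomorphism as soon as its
restriction to the source is. -/
def IsEssential {X Y : 𝒢} (j : X ⟶ Y) : Prop :=
  ∀ ⦃Z : 𝒢⦄ (g : Y ⟶ Z), Mono (j ≫ g) → Mono g

theorem IsEssential.of_isIso {X Y : 𝒢} (j : X ⟶ Y) [IsIso j] : IsEssential j := fun Z g h => by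
  rw [← IsIso.inv_hom_id_assoc j g]
  exact mono_comp _ _

theorem IsEssential.comp {X Y Z : 𝒢} {j : X ⟶ Y} {k : Y ⟶ Z} (hj : IsEssential j)
    (hk : IsEssential k) : IsEssential (j ≫ k) := fun W g h =>
  hk g (hj _ (by rwa [← Category.assoc]))

end Essential

section Hull

variable {𝒢 : Type u} [Category.{v} 𝒢] [Abelian 𝒢] [IsGrothendieckAbelian.{w} 𝒢]

/-- Zorn's lemma on the essential extensions of `Q` inside `I`: by `mono_of_isLUB`, essentiality
passes to suprema of chains. -/
theorem exists_maximal_isEssential {Q I : 𝒢} (i : Q ⟶ I) [Mono i] :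
    ∃ (E : 𝒢) (j : Q ⟶ E) (k : E ⟶ I), Mono k ∧ j ≫ k = i ∧ IsEssential j ∧
      ∀ (E' : 𝒢) (a : E ⟶ E') (b : E' ⟶ I), Mono b → a ≫ b = k → IsEssential a → IsIso a := by
  let P : Set (Subobject I) :=
    {U | ∃ h : Subobject.mk i ≤ U, IsEssential (Subobject.ofLE _ _ h)}
  obtain ⟨E, -, ⟨⟨hiE, hess⟩, hmax⟩⟩ := zorn_le_nonempty₀ P (fun c hcP hc y hy => by
      obtain ⟨s, hs⟩ : ∃ s, IsLUB c s := ⟨sSup c, isLUB_sSup c⟩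
      have hle : Subobject.mk i ≤ s := (hcP hy).1.trans (hs.1 hy)
      refine ⟨s, ⟨hle, fun Z g hg => ?_⟩, fun z hz => hs.1 hz⟩
      refine mono_of_isLUB ⟨y, hy⟩ hc.directedOn hs g fun U hU => ?_
      obtain ⟨hiU, hU'⟩ := hcP hU
      exact hU' _ (by simpa using hg)) (Subobject.mk i)
    ⟨le_rfl, by rw [Subobject.ofLE_refl]; exact .of_isIso _⟩
  refine ⟨E, (Subobject.underlyingIso i).inv ≫ Subobject.ofLE _ _ hiE, E.arrow, inferInstance,
    by simp, (IsEssential.of_isIso _).comp hess, fun E' a b hb hab ha => ?_⟩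
  have hEE' : E ≤ Subobject.mk b := Subobject.le_mk_of_comm a hab
  have ha' : Subobject.ofLE _ _ hEE' = a ≫ (Subobject.underlyingIso b).inv := by
    rw [← cancel_mono (Subobject.mk b).arrow]
    simp [hab]
  have := hmax (y := Subobject.mk b) ⟨hiE.trans hEE', by
    rw [← Subobject.ofLE_comp_ofLE _ _ _ hiE hEE', ha']
    exact hess.comp (ha.comp (.of_isIso _))⟩ hEE'
  have hiso : IsIso (Subobject.ofLE _ _ hEE') :=
    ⟨Subobject.ofLE _ _ this, by simp, by simp⟩
  have : a = Subobject.ofLE _ _ hEE' ≫ (Subobject.underlyingIso b).hom := by simp [ha']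
  rw [this]
  infer_instance

omit [IsGrothendieckAbelian.{w} 𝒢] in
theorem mono_of_kernelSubobject_le {X Z : 𝒢} (W : Subobject X) (g : cokernel W.arrow ⟶ Z)
    (h : kernelSubobject (cokernel.π W.arrow ≫ g) ≤ W) : Mono g := by
  refine Preadditive.mono_of_cancel_zero _ fun {T} x hx => ?_
  obtain ⟨A, π, hπ, y, hy⟩ := surjective_up_to_refinements_of_epi (cokernel.π W.arrow) x
  have h₁ : (kernelSubobject (cokernel.π W.arrow ≫ g)).Factors y :=
    kernelSubobject_factors _ _ (by rw [← reassoc_of% hy, hx, comp_zero])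
  have h₂ := Subobject.factorThru_arrow _ _ (Subobject.factors_of_le _ h h₁)
  rw [← cancel_epi π, hy, comp_zero, ← h₂, Category.assoc, cokernel.condition, comp_zero]

-- Since `q` kills `B` and is injective on `A`, the two subobjects meet trivially, so `B` embeds in
-- `X / A`.
omit [IsGrothendieckAbelian.{w} 𝒢] in
theorem mono_comp_cokernel_π_of_mono_comp {A B X Y : 𝒢} (a : A ⟶ X) (b : B ⟶ X) [Mono a] [Mono b]
    (q : X ⟶ Y) (hb : b ≫ q = 0) [Mono (a ≫ q)] : Mono (b ≫ cokernel.π a) := by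
  refine Preadditive.mono_of_cancel_zero _ fun {T} x hx => ?_
  have h₁ := Abelian.monoLift_comp a (x ≫ b) (by simpa using hx)
  have h₂ : Abelian.monoLift a (x ≫ b) (by simpa using hx) = 0 := by
    rw [← cancel_mono (a ≫ q), reassoc_of% h₁, hb]
    simp
  rw [← cancel_mono b, ← h₁, h₂]
  simp

/-- Divide `I` by a subobject `W` maximal among those meeting `E` trivially. The kernel of a
morphism from `I / W` that is injective on `E` pulls back to a subobject that contains `W` and still
meets `E` trivially, hence equals `W`. -/
theorem exists_epi_isEssential_comp {E I : 𝒢} (k : E ⟶ I) [Mono k] :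
    ∃ (Y : 𝒢) (p : I ⟶ Y), Mono (k ≫ p) ∧ IsEssential (k ≫ p) := by
  let P : Set (Subobject I) := {U | Mono (U.arrow ≫ cokernel.π k)}
  obtain ⟨W, -, ⟨hW, hmax⟩⟩ := zorn_le_nonempty₀ P (fun c hcP hc y hy => by
      obtain ⟨s, hs⟩ : ∃ s, IsLUB c s := ⟨sSup c, isLUB_sSup c⟩
      exact ⟨s, mono_arrow_comp_of_isLUB ⟨y, hy⟩ hc.directedOn hs _ fun U hU => hcP hU,
        fun z hz => hs.1 hz⟩) ⊥ (by
      refine Preadditive.mono_of_cancel_zero _ fun g _ => ?_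
      rw [← cancel_mono (⊥ : Subobject I).arrow]; simp)
  change Mono _ at hW
  refine ⟨cokernel W.arrow, cokernel.π W.arrow,
    mono_comp_cokernel_π_of_mono_comp _ _ _ (cokernel.condition k), fun Z g hg => ?_⟩
  rw [Category.assoc] at hg
  have hle : W ≤ kernelSubobject (cokernel.π W.arrow ≫ g) :=
    le_kernelSubobject _ _ (by simp)
  have hge := hmax (y := kernelSubobject (cokernel.π W.arrow ≫ g))
    (mono_comp_cokernel_π_of_mono_comp _ _ _ (kernelSubobject_arrow_comp _)) hle
  exact mono_of_kernelSubobject_le W g hge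

/-- Every object of a Grothendieck category has an injective hull. -/
theorem exists_injective_hull (Q : 𝒢) :
    ∃ (E : 𝒢) (j : Q ⟶ E), Injective E ∧ Mono j ∧ IsEssential j := by
  obtain ⟨E, j, k, hk, hjk, hj, hmax⟩ := exists_maximal_isEssential (Injective.ι Q)
  obtain ⟨Y, p, hp, hess⟩ := exists_epi_isEssential_comp k
  -- Extending `k` along `E ⟶ Y` embeds `Y` in `I` as an essential extension of `E`. Maximality
  -- makes `E ⟶ Y` an isomorphism, so `E` is a retract of the injective `I`.
  have hfac : (k ≫ p) ≫ Injective.factorThru k (k ≫ p) = k := Injective.comp_factorThru _ _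
  have hmono : Mono (Injective.factorThru k (k ≫ p)) := hess _ (by rw [hfac]; exact hk)
  have hiso := hmax _ (k ≫ p) _ hmono hfac hess
  refine ⟨E, j, ⟨fun {X Y} f i _ => ?_⟩, ?_, hj⟩
  · refine ⟨Injective.factorThru (f ≫ k) i ≫ p ≫ inv (k ≫ p), ?_⟩
    rw [Injective.comp_factorThru_assoc, Category.assoc, ← Category.assoc k, IsIso.hom_inv_id,
      Category.comp_id]
  · have : Mono (j ≫ k) := hjk ▸ inferInstance
    exact mono_of_mono j k

end Hull

/-! ### Length of Hom into an injective object. -/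

section HomLength

variable {𝒢 : Type u} [Category.{v} 𝒢] [Abelian 𝒢]

/-- Precomposition with a morphism, as a linear map over the endomorphism ring of the target. -/
def precompLinear (E : 𝒢) {X Y : 𝒢} (f : X ⟶ Y) : (Y ⟶ E) →ₗ[End E] (X ⟶ E) where
  toFun h := f ≫ h
  map_add' _ _ := Preadditive.comp_add _ _ _ _ _ _
  map_smul' _ _ := (Category.assoc _ _ _).symm

@[simp]
theorem precompLinear_apply (E : 𝒢) {X Y : 𝒢} (f : X ⟶ Y) (h : Y ⟶ E) :
    precompLinear E f h = f ≫ h := rfl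

/-- The length of `X ⟶ E` as a module over the endomorphism ring of `E`. -/
noncomputable def homLength (E X : 𝒢) : ℕ∞ := Module.length (End E) (X ⟶ E)

theorem homLength_eq_zero {E X : 𝒢} (h : ∀ f : X ⟶ E, f = 0) : homLength E X = 0 :=
  Module.length_eq_zero_iff.2 ⟨fun f g => (h f).trans (h g).symm⟩

theorem homLength_le_of_epi (E : 𝒢) {X Y : 𝒢} (f : X ⟶ Y) [Epi f] :
    homLength E Y ≤ homLength E X :=
  Module.length_le_of_injective (precompLinear E f) fun _ _ h => (cancel_epi f).1 h

theorem precompLinear_surjective (E : 𝒢) [Injective E] {X Y : 𝒢} (f : X ⟶ Y) [Mono f] :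
    Function.Surjective (precompLinear E f) :=
  fun h => ⟨Injective.factorThru h f, Injective.comp_factorThru _ _⟩

theorem homLength_le_of_mono (E : 𝒢) [Injective E] {X Y : 𝒢} (f : X ⟶ Y) [Mono f] :
    homLength E X ≤ homLength E Y :=
  Module.length_le_of_surjective _ (precompLinear_surjective E f)

theorem homLength_eq_add_kernel (E : 𝒢) [Injective E] {X Y : 𝒢} (f : X ⟶ Y) [Epi f] :
    homLength E X = homLength E Y + homLength E (kernel f) :=
  Module.length_eq_add_of_exact (precompLinear E f) (precompLinear E (kernel.ι f))
    (fun _ _ h => (cancel_epi f).1 h) (precompLinear_surjective E _) fun g =>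
    ⟨fun h => ⟨Abelian.epiDesc f g h, Abelian.comp_epiDesc f g h⟩, by rintro ⟨h, rfl⟩; simp⟩

/-- Any morphism `C ⟶ E` extends along a monomorphism `g`, so every nonzero element generates the
module, which is therefore simple. -/
theorem homLength_eq_one {E C : 𝒢} [Injective E] {f : C ⟶ E} (hf : f ≠ 0)
    (h : ∀ g : C ⟶ E, g ≠ 0 → Mono g) : homLength E C = 1 := by
  have : IsSimpleModule (End E) (C ⟶ E) := by
    refine isSimpleModule_iff_toSpanSingleton_surjective.2 ⟨⟨f, 0, hf⟩, fun m hm g => ?_⟩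
    have := h m hm
    exact ⟨Injective.factorThru g m, Injective.comp_factorThru g m⟩
  exact Module.length_eq_one _ _

/-- The preimage of a subobject `P` of `N / A` is an extension of `P` by `A`. -/
theorem exists_subobject_homLength_ne_top (E : 𝒢) [Injective E] {N P : 𝒢} (A : Subobject N)
    (m : P ⟶ cokernel A.arrow) [Mono m] (hA : homLength E (A : 𝒢) ≠ ⊤) (hP : homLength E P ≠ ⊤) :
    ∃ A₁ : Subobject N, A ≤ A₁ ∧ homLength E (A₁ : 𝒢) ≠ ⊤ ∧ (A₁ ≤ A → m = 0) := by
  let π := cokernel.π A.arrow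
  refine ⟨Subobject.mk (pullback.fst π m), ?_, ?_, fun h => ?_⟩
  · exact Subobject.le_mk_of_comm (pullback.lift A.arrow 0 (by simp [π])) (pullback.lift_fst _ _ _)
  · have h₁ : homLength E (kernel (pullback.snd π m)) ≤ homLength E (A : 𝒢) := by
      have h₂ : (kernel.ι (pullback.snd π m) ≫ pullback.fst π m) ≫ π = 0 := by
        rw [Category.assoc, pullback.condition, kernel.condition_assoc, zero_comp]
      have : Mono (Abelian.monoLift A.arrow _ h₂) := by
        have : Mono (Abelian.monoLift A.arrow _ h₂ ≫ A.arrow) := by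
          rw [Abelian.monoLift_comp]
          infer_instance
        exact mono_of_mono _ A.arrow
      exact homLength_le_of_mono E (Abelian.monoLift A.arrow _ h₂)
    have h₃ : homLength E (pullback π m) ≠ ⊤ := by
      rw [homLength_eq_add_kernel E (pullback.snd π m)]
      exact WithTop.add_ne_top.2 ⟨hP, ne_top_of_le_ne_top hA h₁⟩
    exact ne_top_of_le_ne_top h₃
      (homLength_le_of_mono E (Subobject.underlyingIso (pullback.fst π m)).hom)
  · have h₁ : pullback.fst π m ≫ π = 0 := by
      rw [← Subobject.ofMkLE_arrow h, Category.assoc, cokernel.condition, comp_zero]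
    rw [pullback.condition] at h₁
    exact zero_of_epi_comp _ h₁

theorem eq_zero_of_bot {X Y : 𝒢} (f : ((⊥ : Subobject X) : 𝒢) ⟶ Y) : f = 0 :=
  ((isZero_zero 𝒢).of_iso Subobject.botCoeIsoZero).eq_of_src _ _

/-- If `C` meets `Q` trivially, then `Q` embeds in `E / C`; by essentiality so does `E`, whence `C`
is zero. -/
theorem IsEssential.eq_zero_of_pullback_snd_eq_zero {C E Q : 𝒢} {j : Q ⟶ E} [Mono j]
    (hj : IsEssential j) (f : C ⟶ E) [Mono f] (h : pullback.snd f j = 0) : f = 0 := by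
  have : Mono (cokernel.π f) := hj _ <| Preadditive.mono_of_cancel_zero _ fun x hx => by
    have h₁ := Abelian.monoLift_comp f (x ≫ j) (by simpa using hx)
    rw [← pullback.lift_snd (f := f) (g := j) _ _ h₁, h, comp_zero]
  rw [← cancel_mono (cokernel.π f), cokernel.condition, zero_comp]

/-- A Noetherian object has a largest subobject of finite length. -/
theorem exists_largest_homLength_ne_top (E N : 𝒢) [Injective E] [IsNoetherianObject N] :
    ∃ A : Subobject N, homLength E (A : 𝒢) ≠ ⊤ ∧
      ∀ (X : 𝒢) (f : X ⟶ cokernel A.arrow), homLength E X ≠ ⊤ → f = 0 := by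
  obtain ⟨A, hA, hmax⟩ := exists_maximal_of_wellFoundedGT
    (fun A : Subobject N => homLength E (A : 𝒢) ≠ ⊤)
    ⟨⊥, by rw [homLength_eq_zero fun f => eq_zero_of_bot f]; simp⟩
  refine ⟨A, hA, fun X f hX => ?_⟩
  obtain ⟨A₁, h₁, h₂, h₃⟩ := exists_subobject_homLength_ne_top E A (image.ι f) hA
    (ne_top_of_le_ne_top hX (homLength_le_of_epi E (factorThruImage f)))
  rw [← image.fac f, h₃ (hmax h₂ h₁), comp_zero]

/-- Take `Y ≤ N` maximal with a nonzero morphism from `N / Y` to `E`. All such morphisms are then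
monomorphisms, so Hom has length one; the intersection of `N / Y` with `Q` inside `E` is nonzero
because `Q` is essential. -/
theorem exists_ne_zero_homLength_ne_top {E N Q : 𝒢} [Injective E] [IsNoetherianObject N]
    (p : N ⟶ Q) (hp : p ≠ 0) [Epi p] (j : Q ⟶ E) [Mono j] (hj : IsEssential j) :
    ∃ (P : 𝒢) (m : P ⟶ Q), Mono m ∧ m ≠ 0 ∧ homLength E P ≠ ⊤ := by
  have hfac := cokernel.π_desc (kernelSubobject p).arrow (p ≫ j) (by simp)
  obtain ⟨Y, ⟨f, hf⟩, hmax⟩ := exists_maximal_of_wellFoundedGT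
    (fun Y : Subobject N => ∃ f : cokernel Y.arrow ⟶ E, f ≠ 0)
    ⟨kernelSubobject p, cokernel.desc _ (p ≫ j) (by simp), fun h => hp (by
      rw [← cancel_mono j, zero_comp, ← hfac, h, comp_zero])⟩
  have hmono (g : cokernel Y.arrow ⟶ E) (hg : g ≠ 0) : Mono g := by
    refine mono_of_kernelSubobject_le Y g (hmax ⟨cokernel.desc _ (cokernel.π Y.arrow ≫ g)
      (kernelSubobject_arrow_comp _), fun h => hg ?_⟩ (le_kernelSubobject _ _ (by simp)))
    have hfac' := cokernel.π_desc (kernelSubobject (cokernel.π Y.arrow ≫ g)).arrow _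
      (kernelSubobject_arrow_comp _)
    rw [← cancel_epi (cokernel.π Y.arrow), comp_zero, ← hfac', h, comp_zero]
  have := hmono f hf
  refine ⟨pullback f j, pullback.snd f j, inferInstance,
    fun h => hf (hj.eq_zero_of_pullback_snd_eq_zero f h),
    ne_top_of_le_ne_top ?_ (homLength_le_of_mono E (pullback.fst f j))⟩
  rw [homLength_eq_one hf hmono]
  simp

end HomLength

/-! ### Detecting an idempotent on a module of finite length. -/

section Detection

variable {𝒢 : Type u} [Category.{v} 𝒢] [Abelian 𝒢] [IsGrothendieckAbelian.{w} 𝒢]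

/-- An idempotent-like nonzero family of endomorphisms of a Noetherian object `N` acts nontrivially
on `A ⟶ E`, for some injective object `E` and some fully invariant subobject `A` of `N` for which
`A ⟶ E` has finite length over the endomorphism ring of `E`. -/
theorem exists_subobject_homLength_ne_top_comp_ne_zero (N : 𝒢) [IsNoetherianObject N] {ι : Type*}
    (e : ι → (N ⟶ N)) (i₀ : ι) (hi₀ : e i₀ ≠ 0)
    (he : ∀ (X : 𝒢) (f : X ⟶ N), (∀ i i', f ≫ e i ≫ e i' = 0) → ∀ i, f ≫ e i = 0) :
    ∃ (E : 𝒢) (A : Subobject N), Injective E ∧ homLength E (A : 𝒢) ≠ ⊤ ∧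
      (∀ s : N ⟶ N, A.Factors (A.arrow ≫ s)) ∧
      ∃ (i : ι) (h : N ⟶ E), A.arrow ≫ e i ≫ h ≠ 0 := by
  -- `A` is maximal among the subobjects killed by all `e i` that have no nonzero morphism to an
  -- injective hull `E` of `N / A`. The largest subobject `A'` of finite length relative to `E`
  -- strictly contains it, so `A'` violates one of the two conditions.
  obtain ⟨A, ⟨heA, E, j, hE, hj, hess, hAE⟩, hmax⟩ := exists_maximal_of_wellFoundedGT
    (fun A : Subobject N => (∀ i, A.arrow ≫ e i = 0) ∧ ∃ (E : 𝒢) (j : cokernel A.arrow ⟶ E),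
      Injective E ∧ Mono j ∧ IsEssential j ∧ ∀ f : (A : 𝒢) ⟶ E, f = 0) (by
    obtain ⟨E, j, hE, hj, hess⟩ := exists_injective_hull (cokernel (⊥ : Subobject N).arrow)
    exact ⟨⊥, fun i => eq_zero_of_bot _, E, j, hE, hj, hess, eq_zero_of_bot⟩)
  have hπ : cokernel.π A.arrow ≠ 0 := fun h => hi₀ (by
    have h₁ := Abelian.monoLift_comp A.arrow (𝟙 N) (by simp [h])
    rw [← Category.id_comp (e i₀), ← h₁, Category.assoc, heA, comp_zero])
  obtain ⟨P, m, hm, hm₀, hP⟩ := exists_ne_zero_homLength_ne_top (cokernel.π A.arrow) hπ j hess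
  obtain ⟨A', hA', hlargest⟩ := exists_largest_homLength_ne_top E N
  have hAA' : A ≤ A' := by
    refine Subobject.le_of_comm (Abelian.monoLift A'.arrow A.arrow (hlargest _ _ ?_))
      (Abelian.monoLift_comp _ _ _)
    rw [homLength_eq_zero hAE]
    simp
  have hnot : ¬ A' ≤ A := fun h => by
    obtain rfl := le_antisymm hAA' h
    exact hm₀ (hlargest _ _ hP)
  refine ⟨E, A', hE, hA', fun s => ?_, ?_⟩
  · rw [← Abelian.monoLift_comp A'.arrow (A'.arrow ≫ s) (hlargest _ _ hA')]
    exact Subobject.factors_comp_arrow _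
  by_contra! hcon
  -- If the `e i` were invisible on `A' ⟶ E`, they would carry `A'` into `A`, because `N / A` embeds
  -- in `E`. As all `e i'` kill `A`, `he` would give that they kill `A'`.
  refine hnot (hmax ⟨he _ _ fun i i' => ?_, ?_⟩ hAA')
  · have h₁ : (A'.arrow ≫ e i) ≫ cokernel.π A.arrow = 0 := by
      rw [← cancel_mono j, zero_comp, Category.assoc, Category.assoc]
      exact hcon i _
    rw [← Category.assoc, ← Abelian.monoLift_comp A.arrow _ h₁, Category.assoc, heA, comp_zero]
  · obtain ⟨E', j', hE', hj', hess'⟩ := exists_injective_hull (cokernel A'.arrow)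
    refine ⟨E', j', hE', hj', hess', fun f => ?_⟩
    -- The image of `f` meets `N / A'` in a subobject of a quotient of `A'`; it has finite length
    -- relative to `E`, so it is zero.
    have h₁ : pullback.snd (image.ι f) j' = 0 := hlargest _ _ <|
      ne_top_of_le_ne_top hA' <| (homLength_le_of_mono E (pullback.fst (image.ι f) j')).trans
        (homLength_le_of_epi E (factorThruImage f))
    rw [← image.fac f, hess'.eq_zero_of_pullback_snd_eq_zero _ h₁, comp_zero]

end Detection

/-! ### Morphisms from a Noetherian object to a coproduct. -/

section FiniteSupport

variable {𝒢 : Type u} [Category.{v} 𝒢] [Abelian 𝒢] [IsGrothendieckAbelian.{w} 𝒢]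

/-- In a Grothendieck category, a morphism from a Noetherian object to a coproduct factors through
a finite subcoproduct. -/
theorem exists_finset_eq_sum_of_isNoetherianObject {ι : Type w} [DecidableEq ι] (Y : ι → 𝒢)
    {N : 𝒢} [IsNoetherianObject N] (f : N ⟶ ∐ Y) :
    ∃ F : Finset ι, f = ∑ i ∈ F, (f ≫ Sigma.π Y i) ≫ Sigma.ι Y i := by
  -- `p F` erases the components in `F`. The kernels of `f ≫ p F` stabilize at some `F₀`, and the
  -- goal becomes `f ≫ p F₀ = 0`.
  let p (F : Finset ι) : ∐ Y ⟶ ∐ Y := 𝟙 _ - ∑ i ∈ F, Sigma.π Y i ≫ Sigma.ι Y i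
  have hp (F : Finset ι) (i : ι) : Sigma.ι Y i ≫ p F = if i ∈ F then 0 else Sigma.ι Y i := by
    have h (k : ι) : Sigma.ι Y i ≫ Sigma.π Y k ≫ Sigma.ι Y k =
        if i = k then Sigma.ι Y i else 0 := by
      split_ifs with h
      · subst h; simp
      · rw [Sigma.ι_π_of_ne_assoc _ h, zero_comp]
    simp only [p, Preadditive.comp_sub, Category.comp_id, Preadditive.comp_sum, h,
      Finset.sum_ite_eq]
    split_ifs <;> simp
  have hpp (F F' : Finset ι) : p F ≫ p F' = p (F ∪ F') := by
    refine Sigma.hom_ext _ _ fun i => ?_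
    rw [← Category.assoc, hp, hp]
    by_cases h : i ∈ F <;> simp [h, hp]
  obtain ⟨_, ⟨F₀, rfl⟩, hmax⟩ := exists_maximal_of_wellFoundedGT
    (fun K : Subobject N => K ∈ Set.range fun F => kernelSubobject (f ≫ p F)) ⟨_, ∅, rfl⟩
  have hF₀ (F : Finset ι) : kernelSubobject (f ≫ p (F₀ ∪ F)) ≤ kernelSubobject (f ≫ p F₀) :=
    hmax ⟨_, rfl⟩ (le_kernelSubobject _ _ (by
      rw [← hpp, ← Category.assoc f, kernelSubobject_arrow_comp_assoc, zero_comp]))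
  have hlub : IsLUB (Set.range fun F => kernelSubobject (p F)) ⊤ := by
    refine ⟨fun _ _ => le_top, fun U hU => ?_⟩
    have h₁ : cokernel.π U.arrow = 0 := by
      refine Sigma.hom_ext _ _ fun i => ?_
      have h₂ : U.Factors (Sigma.ι Y i) := Subobject.factors_of_le _ (hU (Set.mem_range_self {i}))
        (kernelSubobject_factors _ _ (by rw [hp]; simp))
      rw [← Subobject.factorThru_arrow _ _ h₂, Category.assoc, cokernel.condition]
      simp
    have : Epi U.arrow := Preadditive.epi_of_cokernel_zero h₁
    have : IsIso U.arrow := isIso_of_mono_of_epi _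
    rw [Subobject.eq_top_of_isIso_arrow U]
  let m := image.ι (f ≫ p F₀)
  -- The image of `f ≫ p F₀` meets each kernel of `p F` trivially, by the choice of `F₀`. These
  -- kernels are directed with supremum the whole coproduct, so the image meets everything trivially
  -- and is zero.
  have hmono : Mono ((⊤ : Subobject (∐ Y)).arrow ≫ cokernel.π m) := by
    refine mono_arrow_comp_of_isLUB (Set.range_nonempty _) ?_ hlub _ ?_
    · rintro _ ⟨F, rfl⟩ _ ⟨F', rfl⟩
      refine ⟨_, ⟨F ∪ F', rfl⟩, le_kernelSubobject _ _ ?_, le_kernelSubobject _ _ ?_⟩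
      · rw [← hpp, kernelSubobject_arrow_comp_assoc, zero_comp]
      · rw [Finset.union_comm, ← hpp, kernelSubobject_arrow_comp_assoc, zero_comp]
    · rintro _ ⟨F, rfl⟩
      refine Preadditive.mono_of_cancel_zero _ fun {T} x hx => ?_
      have h₁ := Abelian.monoLift_comp m (x ≫ (kernelSubobject (p F)).arrow) (by simpa using hx)
      obtain ⟨B, a, ha, y, hy⟩ := surjective_up_to_refinements_of_epi
        (factorThruImage (f ≫ p F₀)) (Abelian.monoLift m (x ≫ (kernelSubobject (p F)).arrow)
          (by simpa using hx))
      have h₂ : a ≫ x ≫ (kernelSubobject (p F)).arrow = y ≫ f ≫ p F₀ := by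
        rw [← h₁, reassoc_of% hy, image.fac]
      have h₃ : (kernelSubobject (f ≫ p (F₀ ∪ F))).Factors y := by
        refine kernelSubobject_factors _ _ ?_
        have h₄ := congrArg (· ≫ p F) h₂
        simp only [Category.assoc, kernelSubobject_arrow_comp, comp_zero, hpp] at h₄
        exact h₄.symm
      have h₄ := Subobject.factorThru_arrow _ _ (Subobject.factors_of_le _ (hF₀ F) h₃)
      rw [← h₄, Category.assoc, kernelSubobject_arrow_comp, comp_zero] at h₂
      rw [← cancel_epi a, ← cancel_mono (kernelSubobject (p F)).arrow, Category.assoc, h₂]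
      simp
  refine ⟨F₀, ?_⟩
  have h₁ : f ≫ p F₀ = 0 := by
    have hq : Mono (cokernel.π m) := by
      rw [← IsIso.inv_hom_id_assoc (⊤ : Subobject (∐ Y)).arrow (cokernel.π m)]
      exact mono_comp _ _
    have hm : m = 0 := by rw [← cancel_mono (cokernel.π m), cokernel.condition, zero_comp]
    refine (image.fac (f ≫ p F₀)).symm.trans ?_
    change _ ≫ m = 0
    rw [hm, comp_zero]
  simp only [p, Preadditive.comp_sub, Category.comp_id, Preadditive.comp_sum, sub_eq_zero] at h₁
  simpa using h₁

end FiniteSupport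

/-! ### Embedding the endomorphism ring in a group ring. -/

section GroupRing

variable {𝒢 : Type u} [Category.{v} 𝒢] [Abelian 𝒢] [IsGrothendieckAbelian.{w} 𝒢]
  {G : Type w} [Group G]

/-- The coefficients are the components of the restriction to the copy of index 1. Their convolution
follows the order of `≫`, opposite to that of `*` in `End`; hence the opposite coefficient ring and
the reversal of products, harmless for direct finiteness. -/
theorem exists_monoidAlgebra_of_extendTrivial (N : 𝒢) [IsNoetherianObject N] :
    ∃ Φ : End ((extendTrivial G 𝒢).obj N) → MonoidAlgebra (End N)ᵐᵒᵖ G,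
      Function.Injective Φ ∧ Φ 1 = 1 ∧ ∀ x y, Φ (x * y) = Φ y * Φ x := by
  classical
  let Y : G → 𝒢 := fun _ => N
  let X : RepCat G 𝒢 := (extendTrivial G 𝒢).obj N
  let ρ (g : G) : ∐ Y ⟶ ∐ Y := X.map (X := SingleObj.star G) (Y := SingleObj.star G) g
  have hρ (g h : G) : Sigma.ι Y h ≫ ρ g = Sigma.ι Y (g * h) := Sigma.ι_desc _ _
  have hδ (g h : G) : (Sigma.ι Y g ≫ Sigma.π Y h : N ⟶ N) = if g = h then 𝟙 N else 0 := by
    split_ifs with hgh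
    · subst hgh; exact Sigma.ι_π_eq_id Y g
    · exact Sigma.ι_π_of_ne Y hgh
  have hρπ (g h : G) : ρ g ≫ Sigma.π Y h = Sigma.π Y (g⁻¹ * h) := by
    refine Sigma.hom_ext _ _ fun k => ?_
    have h₁ := hδ (g * k) h
    rw [← hρ, Category.assoc] at h₁
    refine h₁.trans (Eq.trans ?_ (hδ k (g⁻¹ * h)).symm)
    simp only [eq_inv_mul_iff_mul_eq]
  let a (x : End X) : ∐ Y ⟶ ∐ Y := x.app (SingleObj.star G)
  have ha (x : End X) (g : G) : ρ g ≫ a x = a x ≫ ρ g := x.naturality g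
  let c (x : End X) (g : G) : N ⟶ N := (Sigma.ι Y 1 ≫ a x) ≫ Sigma.π Y g
  have hc (x : End X) : ∃ F : Finset G, (∀ F', F ⊆ F' →
      Sigma.ι Y 1 ≫ a x = ∑ g ∈ F', c x g ≫ Sigma.ι Y g) ∧ ∀ g, c x g ≠ 0 → g ∈ F := by
    obtain ⟨F, hF⟩ := exists_finset_eq_sum_of_isNoetherianObject Y (Sigma.ι Y 1 ≫ a x)
    have hF' (g : G) (hg : c x g ≠ 0) : g ∈ F := by
      refine by_contra fun hgF => hg ?_
      change (Sigma.ι Y 1 ≫ a x) ≫ Sigma.π Y g = 0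
      rw [hF, Preadditive.sum_comp]
      refine Finset.sum_eq_zero fun i hi => ?_
      rw [Category.assoc, Sigma.ι_π_of_ne _ (by rintro rfl; exact hgF hi), comp_zero]
    refine ⟨F, fun F' hFF' => hF.trans (Finset.sum_subset hFF' fun g _ hg => ?_), hF'⟩
    rw [show (Sigma.ι Y 1 ≫ a x) ≫ Sigma.π Y g = 0 from of_not_not fun h => hg (hF' g h),
      zero_comp]
  have hfin (x : End X) : (Function.support fun g => MulOpposite.op (c x g : End N)).Finite := by
    obtain ⟨F, -, hF⟩ := hc x
    exact F.finite_toSet.subset fun g hg => hF g fun h => hg (congrArg MulOpposite.op h)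
  let Φ (x : End X) : MonoidAlgebra (End N)ᵐᵒᵖ G := .ofCoeff (.ofSupportFinite _ (hfin x))
  have hΦ (x : End X) (g : G) : (Φ x).coeff g = MulOpposite.op (c x g) := rfl
  refine ⟨Φ, fun x y hxy => ?_, ?_, fun x y => ?_⟩
  · have h₁ (g : G) : c x g = c y g := by
      have h := congrArg (fun z => MulOpposite.unop (z.coeff g)) hxy
      exact h
    have h₂ : Sigma.ι Y 1 ≫ a x = Sigma.ι Y 1 ≫ a y := by
      obtain ⟨F, hF, -⟩ := hc x
      obtain ⟨F', hF', -⟩ := hc y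
      rw [hF (F ∪ F') Finset.subset_union_left, hF' (F ∪ F') Finset.subset_union_right]
      simp only [h₁]
    have h₃ : a x = a y := by
      refine Sigma.hom_ext _ _ fun g => ?_
      rw [← mul_one g, ← hρ, Category.assoc, Category.assoc, ha, ha, ← Category.assoc, h₂,
        Category.assoc]
    refine NatTrans.ext (funext fun b => ?_)
    obtain rfl : b = SingleObj.star G := rfl
    exact h₃
  · ext g
    have ha1 : a 1 = 𝟙 _ := rfl
    rw [hΦ, MonoidAlgebra.one_def, MonoidAlgebra.coeff_single, Finsupp.single_apply]
    simp only [c, ha1, Category.comp_id]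
    split_ifs with h
    · subst h; exact congrArg MulOpposite.op (Sigma.ι_π_eq_id Y 1)
    · rw [Sigma.ι_π_of_ne _ h]; rfl
  · ext k
    obtain ⟨F, hF, hF'⟩ := hc y
    rw [MonoidAlgebra.coeff_mul_apply_left, Finsupp.sum_of_support_subset (s := F)]
    · simp only [hΦ]
      change MulOpposite.op ((Sigma.ι Y 1 ≫ a y ≫ a x) ≫ Sigma.π Y k) = _
      rw [← Category.assoc, hF F subset_rfl, Preadditive.sum_comp, Preadditive.sum_comp]
      refine (Finset.op_sum _ _).trans (Finset.sum_congr rfl fun g _ => ?_)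
      have h : Sigma.ι Y g ≫ a x ≫ Sigma.π Y k = (c x (g⁻¹ * k) : N ⟶ N) := by
        have h₁ : Sigma.ι Y g = Sigma.ι Y 1 ≫ ρ g := by rw [hρ, mul_one]
        rw [h₁]
        change (Sigma.ι Y 1 ≫ ρ g) ≫ a x ≫ Sigma.π Y k = (Sigma.ι Y 1 ≫ a x) ≫ _
        rw [Category.assoc, ← Category.assoc (ρ g), ha, Category.assoc, hρπ, Category.assoc]
      rw [Category.assoc, Category.assoc, h]
      rfl
    · intro g hg
      exact hF' g fun h => Finsupp.mem_support_iff.1 hg (congrArg MulOpposite.op h)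
    · simp

end GroupRing

/-! ### Paths, and charts modeled on the Cayley graph. -/

namespace LabeledDigraph

section Path

variable {B V : Type*} {Γ : LabeledDigraph B V}

theorem mem_nbhd_iff {r : ℕ} {x y : V} : y ∈ Γ.nbhd r x ↔ ∃ n ≤ r, Γ.HasPath n x y := by
  constructor
  · intro h
    by_contra! hcon
    have h₁ : ((r + 1 : ℕ) : ℕ∞) ≤ Γ.dist x y := le_iInf₂ fun n hn =>
      Nat.cast_le.2 (Nat.succ_le_of_lt (not_le.1 fun h' => hcon n h' hn))
    have h₂ : ((r + 1 : ℕ) : ℕ∞) ≤ (r : ℕ) := h₁.trans h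
    exact absurd (Nat.cast_le.1 h₂) (by omega)
  · rintro ⟨n, hn, h⟩
    exact (iInf₂_le (f := fun (n : ℕ) (_ : Γ.HasPath n x y) => (n : ℕ∞)) n h).trans
      (Nat.cast_le.2 hn)

theorem HasPath.trans {m n : ℕ} {x y z : V} (h₁ : Γ.HasPath m x y) (h₂ : Γ.HasPath n y z) :
    Γ.HasPath (m + n) x z := by
  induction m generalizing x with
  | zero => obtain rfl : x = y := h₁; rwa [zero_add]
  | succ m ih =>
    obtain ⟨w, hw, h⟩ := h₁
    rw [Nat.succ_add]
    exact ⟨w, hw, ih h⟩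

theorem HasPath.of_mem_edge {x y : V} (h : (x, y) ∈ Γ.edge) : Γ.HasPath 1 x y :=
  ⟨y, h, rfl⟩

end Path

section Cayley

open scoped Pointwise

variable {G : Type*} [Group G] {B : Set G}

theorem finite_pow (hB : B.Finite) (n : ℕ) : (B ^ n).Finite := by
  induction n with
  | zero => simp
  | succ n ih => rw [pow_succ]; exact ih.mul hB

theorem hasPath_cayley_iff {n : ℕ} {x y : G} :
    (cayley B).HasPath n x y ↔ x⁻¹ * y ∈ B ^ n := by
  induction n generalizing x with
  | zero => simp [HasPath, inv_mul_eq_one]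
  | succ n ih =>
    rw [pow_succ', Set.mem_mul]
    constructor
    · rintro ⟨z, hz, h⟩
      exact ⟨x⁻¹ * z, hz, z⁻¹ * y, ih.1 h, by group⟩
    · rintro ⟨b, hb, c, hc, h⟩
      refine ⟨x * b, by simpa [cayley] using hb, ih.2 ?_⟩
      rwa [mul_inv_rev, mul_assoc, ← h, inv_mul_cancel_left]

theorem nbhd_cayley_one (h1 : 1 ∈ B) (r : ℕ) : (cayley B).nbhd r 1 = B ^ r := by
  ext y
  rw [mem_nbhd_iff]
  constructor
  · rintro ⟨n, hn, h⟩
    rw [hasPath_cayley_iff] at h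
    exact Set.pow_subset_pow_right h1 hn (by simpa using h)
  · intro h
    exact ⟨r, le_rfl, hasPath_cayley_iff.2 (by simpa using h)⟩

/-- A chart of radius `r` at the vertex `x`: an isomorphism between the `r`-th neighborhood of the
identity in the Cayley graph and the `r`-th neighborhood of `x` that maps the identity to `x`. -/
structure Chart {V : Type*} (Γ : LabeledDigraph B V) (r : ℕ) (x : V) where
  toFun : G → V
  map_one : toFun 1 = x
  injOn : Set.InjOn toFun (B ^ r)
  surjOn : ∀ y ∈ Γ.nbhd r x, ∃ k ∈ B ^ r, toFun k = y
  edge_iff : ∀ k ∈ B ^ r, ∀ k' ∈ B ^ r, (toFun k, toFun k') ∈ Γ.edge ↔ k⁻¹ * k' ∈ B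
  label_eq : ∀ k ∈ B ^ r, ∀ k' ∈ B ^ r, ∀ h : (toFun k, toFun k') ∈ Γ.edge,
    (Γ.label ⟨_, h⟩ : G) = k⁻¹ * k'

variable {V : Type*} {Γ : LabeledDigraph B V} {r : ℕ} {x : V}

theorem Iso.hasPath_cayley {s : Set G}
    (φ : Iso (Γ.induce (Γ.nbhd r x)) ((cayley B).induce s)) {i n : ℕ}
    {u y : Γ.nbhd r x} (hu : Γ.HasPath i x u) (h : Γ.HasPath n u y) (hr : i + n ≤ r) :
    (cayley B).HasPath n (φ.toEquiv u) (φ.toEquiv y) := by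
  induction n generalizing u i with
  | zero => exact congrArg (fun v => (φ.toEquiv v : G)) (Subtype.ext h)
  | succ n ih =>
    obtain ⟨z, hz, h⟩ := h
    have hxz := hu.trans (.of_mem_edge hz)
    let z' : Γ.nbhd r x := ⟨z, mem_nbhd_iff.2 ⟨i + 1, by omega, hxz⟩⟩
    exact ⟨φ.toEquiv z', (φ.edge_iff u z').1 hz, ih (u := z') hxz h (by omega)⟩

/-- The isomorphism may send `x` to some `g ≠ 1`. Every vertex of the ball is reached from `x`
within `r` steps, so `g⁻¹ B ^ r ⊆ B ^ r`. Finiteness turns this into equality, and translation by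
`g` recenters the isomorphism. -/
theorem nonempty_chart (hB : B.Finite) (h1 : 1 ∈ B)
    (φ : Iso (Γ.induce (Γ.nbhd r x)) ((cayley B).induce ((cayley B).nbhd r 1))) :
    Nonempty (Chart Γ r x) := by
  classical
  rw [nbhd_cayley_one h1] at φ
  let x₀ : Γ.nbhd r x := ⟨x, mem_nbhd_iff.2 ⟨0, Nat.zero_le _, rfl⟩⟩
  let g : G := φ.toEquiv x₀
  have hsub : (g⁻¹ * ·) '' (B ^ r) ⊆ B ^ r := by
    rintro _ ⟨k, hk, rfl⟩
    obtain ⟨n, hn, h⟩ := mem_nbhd_iff.1 (φ.toEquiv.symm ⟨k, hk⟩).2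
    have := φ.hasPath_cayley (i := 0) (u := x₀) rfl h (by omega)
    rw [Equiv.apply_symm_apply, hasPath_cayley_iff] at this
    exact Set.pow_subset_pow_right h1 hn this
  have heq := Set.eq_of_subset_of_ncard_le hsub
    (Set.ncard_image_of_injective _ (mul_right_injective g⁻¹)).ge (finite_pow hB r)
  have hg (k : G) (hk : k ∈ B ^ r) : g * k ∈ B ^ r := by
    rw [← heq] at hk
    obtain ⟨k', hk', rfl⟩ := hk
    simpa using hk'
  let θ (k : G) : V := if h : g * k ∈ B ^ r then φ.toEquiv.symm ⟨g * k, h⟩ else x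
  have hθ (k : G) (hk : k ∈ B ^ r) : θ k = φ.toEquiv.symm ⟨g * k, hg k hk⟩ := dif_pos (hg k hk)
  have hedge (k k' : G) (hk : k ∈ B ^ r) (hk' : k' ∈ B ^ r) := φ.edge_iff
      (φ.toEquiv.symm ⟨g * k, hg k hk⟩) (φ.toEquiv.symm ⟨g * k', hg k' hk'⟩)
  have hone : (1 : G) ∈ B ^ r := Set.one_mem_pow h1
  refine ⟨⟨θ, ?_, ?_, ?_, ?_, ?_⟩⟩
  · rw [hθ 1 hone]
    have : (⟨g * 1, hg 1 hone⟩ : (B ^ r : Set G)) = φ.toEquiv x₀ := Subtype.ext (mul_one g)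
    rw [this, Equiv.symm_apply_apply]
  · intro k hk k' hk' h
    rw [hθ k hk, hθ k' hk'] at h
    simpa using φ.toEquiv.symm.injective (Subtype.ext h)
  · intro y hy
    have h₁ : g⁻¹ * (φ.toEquiv ⟨y, hy⟩ : G) ∈ B ^ r := hsub ⟨_, (φ.toEquiv ⟨y, hy⟩).2, rfl⟩
    refine ⟨_, h₁, ?_⟩
    rw [hθ _ h₁]
    simp
  · intro k hk k' hk'
    rw [hθ k hk, hθ k' hk']
    refine (hedge k k' hk hk').trans ?_
    simp [induce, cayley, mul_assoc]
  · intro k hk k' hk' h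
    simp only [hθ k hk, hθ k' hk'] at h ⊢
    have h₁ := φ.label_eq (φ.toEquiv.symm ⟨g * k, hg k hk⟩) (φ.toEquiv.symm ⟨g * k', hg k' hk'⟩) h
    refine (congrArg Subtype.val h₁).trans ?_
    simp [induce, cayley, mul_assoc]

namespace Chart

variable (θ : Chart Γ r x)

theorem hasPath (h1 : 1 ∈ B) {i m : ℕ} {j k : G} (hj : j ∈ B ^ i) (hk : k ∈ B ^ m)
    (h : i + m ≤ r) : Γ.HasPath m (θ.toFun j) (θ.toFun (j * k)) := by
  induction m generalizing i j k with
  | zero =>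
    obtain rfl : k = 1 := by simpa using hk
    rw [mul_one]; rfl
  | succ m ih =>
    rw [pow_succ'] at hk
    obtain ⟨b, hb, c, hc, rfl⟩ := hk
    have hjb : j * b ∈ B ^ (i + 1) := by rw [pow_succ]; exact Set.mul_mem_mul hj hb
    refine ⟨θ.toFun (j * b), (θ.edge_iff _ (Set.pow_subset_pow_right h1 (by omega) hj) _
      (Set.pow_subset_pow_right h1 (by omega) hjb)).2 (by simpa using hb), ?_⟩
    simpa [mul_assoc] using ih hjb hc (by omega)

/-- Strictness of `m < r` keeps the target of the edge inside the ball, so no edge leaving the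
chart's interior is missed. -/
theorem toFun_mul_label (h1 : 1 ∈ B) {m : ℕ} (hm : m < r) {k : G} (hk : k ∈ B ^ m) {y : V}
    (h : (θ.toFun k, y) ∈ Γ.edge) : θ.toFun (k * (Γ.label ⟨_, h⟩ : G)) = y := by
  have h₁ : Γ.HasPath m x (θ.toFun k) := by
    have := θ.hasPath h1 (i := 0) (j := 1) (by simp) hk (by omega)
    rwa [θ.map_one, one_mul] at this
  obtain ⟨k', hk', rfl⟩ := θ.surjOn y (mem_nbhd_iff.2 ⟨m + 1, hm, h₁.trans (.of_mem_edge h)⟩)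
  rw [θ.label_eq k (Set.pow_subset_pow_right h1 hm.le hk) k' hk' h, mul_inv_cancel_left]

theorem exists_label_eq (h1 : 1 ∈ B) {m : ℕ} (hm : m < r) {k b : G} (hk : k ∈ B ^ m)
    (hb : b ∈ B) : ∃ h : (θ.toFun k, θ.toFun (k * b)) ∈ Γ.edge, (Γ.label ⟨_, h⟩ : G) = b := by
  have h₁ := Set.pow_subset_pow_right h1 hm.le hk
  have h₂ : k * b ∈ B ^ r := Set.pow_subset_pow_right h1 hm
    (by rw [pow_succ]; exact Set.mul_mem_mul hk hb)
  have h₃ := (θ.edge_iff k h₁ _ h₂).2 (by simpa using hb)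
  exact ⟨h₃, by rw [θ.label_eq k h₁ _ h₂ h₃, inv_mul_cancel_left]⟩

theorem inv_mem_pow (hinv : ∀ b ∈ B, b⁻¹ ∈ B) {n : ℕ} {k : G} (hk : k ∈ B ^ n) : k⁻¹ ∈ B ^ n := by
  have : B⁻¹ = B := by
    ext b
    exact ⟨fun h => by simpa using hinv _ h, fun h => hinv b h⟩
  rwa [← Set.mem_inv, ← inv_pow, this]

/-- If the `n`-th neighborhoods of `x` and `x'` meet, then `x'` is in the `2n`-th neighborhood
of `x`. -/
theorem exists_toFun_eq_of_toFun_eq (h1 : 1 ∈ B) (hinv : ∀ b ∈ B, b⁻¹ ∈ B) {x' : V} {n : ℕ}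
    (hn : n + n = r) (θ' : Chart Γ r x') {k k' : G} (hk : k ∈ B ^ n) (hk' : k' ∈ B ^ n)
    (h : θ.toFun k = θ'.toFun k') : ∃ j ∈ B ^ r, θ.toFun j = x' := by
  refine θ.surjOn x' (mem_nbhd_iff.2 ⟨n + n, hn.le, ?_⟩)
  have h₁ := θ.hasPath h1 (i := 0) (j := 1) (by simp) hk (by omega)
  have h₂ := θ'.hasPath h1 hk' (inv_mem_pow hinv hk') hn.le
  rw [mul_inv_cancel, θ'.map_one] at h₂
  rw [θ.map_one, one_mul, h] at h₁
  exact h₁.trans h₂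

end Chart

end Cayley

end LabeledDigraph

/-! ### Action of the group ring on functions. -/

section ConvAct

variable (D H G : Type*) [Ring D] [AddCommGroup H] [Module D H] [Group G]

/-- The action of the group ring of `G` over the endomorphism ring of a module `H` on the
functions from `G` to `H`. -/
noncomputable def convAct : MonoidAlgebra (Module.End D H) G →+* Module.End D (G → H) :=
  MonoidAlgebra.liftNCRingHom
    { toFun := fun s => s.compLeft G
      map_one' := rfl
      map_mul' := fun _ _ => rfl
      map_zero' := rfl
      map_add' := fun _ _ => rfl }
    { toFun := fun g => LinearMap.funLeft D H fun k => k * g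
      map_one' := by ext; simp
      map_mul' := fun g h => by
        refine LinearMap.ext fun F => funext fun k => ?_
        simp [mul_assoc] }
    fun _ _ => rfl

variable {D H G}

theorem convAct_single (g : G) (s : Module.End D H) (F : G → H) (k : G) :
    convAct D H G (.single g s) F k = s (F (k * g)) :=
  congrFun (LinearMap.congr_fun (MonoidAlgebra.liftNCRingHom_single _ _ _ g s) F) k

theorem convAct_apply (x : MonoidAlgebra (Module.End D H) G) (F : G → H) (k : G) :
    convAct D H G x F k = ∑ b ∈ x.coeff.support, x.coeff b (F (k * b)) := by
  conv_lhs => rw [← MonoidAlgebra.sum_coeff_single x, Finsupp.sum, map_sum]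
  simp only [LinearMap.sum_apply, Finset.sum_apply, convAct_single]

theorem convAct_congr {x : MonoidAlgebra (Module.End D H) G} {F F' : G → H} {k : G}
    (h : ∀ b ∈ x.coeff.support, F (k * b) = F' (k * b)) :
    convAct D H G x F k = convAct D H G x F' k := by
  rw [convAct_apply, convAct_apply]
  exact Finset.sum_congr rfl fun b hb => by rw [h b hb]

theorem exists_convAct_one_ne_zero {e : MonoidAlgebra (Module.End D H) G} (he : e ≠ 0) :
    ∃ F : G → H, convAct D H G e F 1 ≠ 0 := by
  classical
  obtain ⟨g, hg⟩ : ∃ g, e.coeff g ≠ 0 := by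
    by_contra! h
    exact he (MonoidAlgebra.ext (Finsupp.ext h))
  obtain ⟨a, ha⟩ : ∃ a, e.coeff g a ≠ 0 := by
    by_contra! h
    exact hg (LinearMap.ext h)
  refine ⟨Pi.single g a, ?_⟩
  rw [convAct_apply, Finset.sum_eq_single g]
  · simpa using ha
  · intro b _ hb
    rw [one_mul, Pi.single_eq_of_ne hb, map_zero]
  · intro hg'
    simp [Finsupp.notMem_support_iff.1 hg']

end ConvAct

/-! ### Convolution on a finite digraph and the length inequality. -/

namespace LabeledDigraph

open scoped Pointwise

variable {D H G : Type*} [Ring D] [AddCommGroup H] [Module D H] [Group G] {B : Set G}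
  {V : Type*} [Fintype V] (Γ : LabeledDigraph B V)

open scoped Classical in
/-- The convolution along a labeled digraph by an element of the group ring. -/
noncomputable def labelAct (x : MonoidAlgebra (Module.End D H) G) :
    (V → H) →ₗ[D] (V → H) :=
  LinearMap.pi fun v => ∑ w, (if h : (v, w) ∈ Γ.edge then x.coeff (Γ.label ⟨_, h⟩ : G) else 0) ∘ₗ
    LinearMap.proj w

omit [Group G] in
open scoped Classical in
theorem labelAct_apply (x : MonoidAlgebra (Module.End D H) G) (f : V → H) (v : V) :
    Γ.labelAct x f v =
      ∑ w, if h : (v, w) ∈ Γ.edge then x.coeff (Γ.label ⟨_, h⟩ : G) (f w) else 0 := by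
  simp only [labelAct, LinearMap.pi_apply, LinearMap.sum_apply, LinearMap.comp_apply,
    LinearMap.proj_apply]
  refine Finset.sum_congr rfl fun w _ => ?_
  split_ifs <;> rfl

variable {Γ} {r : ℕ} {v : V}

theorem Chart.labelAct_toFun (θ : Chart Γ r v) (h1 : 1 ∈ B)
    {x : MonoidAlgebra (Module.End D H) G} (hx : (x.coeff.support : Set G) ⊆ B) (f : V → H)
    {m : ℕ} (hm : m < r) {k : G} (hk : k ∈ B ^ m) :
    Γ.labelAct x f (θ.toFun k) = convAct D H G x (f ∘ θ.toFun) k := by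
  classical
  rw [labelAct_apply, convAct_apply]
  have hmem (b : G) (hb : b ∈ x.coeff.support) : k * b ∈ B ^ r :=
    Set.pow_subset_pow_right h1 hm (by rw [pow_succ]; exact Set.mul_mem_mul hk (hx hb))
  rw [← Finset.sum_subset (Finset.subset_univ (x.coeff.support.image fun b => θ.toFun (k * b))),
    Finset.sum_image]
  · refine Finset.sum_congr rfl fun b hb => ?_
    obtain ⟨h₁, h₂⟩ := θ.exists_label_eq h1 hm hk (hx hb)
    rw [dif_pos h₁, h₂]
    rfl
  · intro b hb b' hb' h
    exact mul_left_cancel (θ.injOn (hmem b hb) (hmem b' hb') h)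
  · intro w _ hw
    split_ifs with h
    · rw [Finsupp.notMem_support_iff.1 fun h' => hw (Finset.mem_image.2
        ⟨_, h', θ.toFun_mul_label h1 hm hk h⟩)]
      rfl
    · rfl

theorem Chart.labelAct_labelAct_toFun (θ : Chart Γ r v) (h1 : 1 ∈ B)
    {x y : MonoidAlgebra (Module.End D H) G} (hx : (x.coeff.support : Set G) ⊆ B)
    (hy : (y.coeff.support : Set G) ⊆ B) (f : V → H)
    {m : ℕ} (hm : m + 1 < r) {k : G} (hk : k ∈ B ^ m) :
    Γ.labelAct x (Γ.labelAct y f) (θ.toFun k) = convAct D H G (x * y) (f ∘ θ.toFun) k := by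
  rw [θ.labelAct_toFun h1 hx _ (by omega) hk, map_mul]
  refine convAct_congr fun b hb => θ.labelAct_toFun h1 hy _ hm ?_
  rw [pow_succ]
  exact Set.mul_mem_mul hk (hx hb)

/-- The outer `y` reads values only at chart points of `B`, where `x * y` acts as the identity;
three successive steps explain `2 < r`. -/
theorem Chart.labelAct_labelAct_labelAct (θ : Chart Γ r v) (h1 : 1 ∈ B)
    {x y : MonoidAlgebra (Module.End D H) G} (hx : (x.coeff.support : Set G) ⊆ B)
    (hy : (y.coeff.support : Set G) ⊆ B) (hxy : x * y = 1) (hr : 2 < r) (f : V → H) :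
    Γ.labelAct y (Γ.labelAct x (Γ.labelAct y f)) v = Γ.labelAct y f v := by
  rw [← θ.map_one, θ.labelAct_toFun h1 hy _ (m := 0) (by omega) (by simp),
    θ.labelAct_toFun h1 hy _ (m := 0) (by omega) (by simp)]
  refine convAct_congr fun b hb => ?_
  have := θ.labelAct_labelAct_toFun h1 hx hy f (m := 1) (k := 1 * b) hr
    (by rw [one_mul, pow_one]; exact hy hb)
  refine this.trans ?_
  rw [hxy, _root_.map_one]
  rfl

theorem card_mul_length_add_card_le (h1 : 1 ∈ B)
    {x y : MonoidAlgebra (Module.End D H) G} (hx : (x.coeff.support : Set G) ⊆ B)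
    (hy : (y.coeff.support : Set G) ⊆ B) (hxy : x * y = 1) (hyx : y * x ≠ 1)
    (hr : 2 < r) (V₀ V₂ : Finset V) (hV : V₂ ⊆ V₀) (θ : ∀ v ∈ V₀, Chart Γ r v)
    (hdisj : ∀ v (hv : v ∈ V₂) v' (hv' : v' ∈ V₂), ∀ k ∈ B ^ 2, ∀ k' ∈ B ^ 2,
      (θ v (hV hv)).toFun k = (θ v' (hV hv')).toFun k' → v = v') :
    (V₀.card : ℕ∞) * Module.length D H + V₂.card ≤ (Fintype.card V : ℕ∞) * Module.length D H := by
  classical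
  let W := LinearMap.range (Γ.labelAct y : (V → H) →ₗ[D] (V → H))
  have hlen : Module.length D (V → H) = Module.length D W + Module.length D ((V → H) ⧸ W) :=
    Module.length_eq_add_of_exact W.subtype W.mkQ W.subtype_injective W.mkQ_surjective
      (LinearMap.exact_subtype_mkQ W)
  have hpi (ι : Type _) [Fintype ι] :
      Module.length D (ι → H) = Fintype.card ι * Module.length D H := by
    simp [Module.length_pi_of_fintype]
  rw [hpi] at hlen
  rw [hlen]
  refine add_le_add ?_ ?_
  -- On `V₀` the action of `x` undoes that of `y`, so the image `W` of `y` surjects onto `V₀ → H`.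
  · let R : W →ₗ[D] (V₀ → H) :=
      LinearMap.funLeft D H (Subtype.val : V₀ → V) ∘ₗ Γ.labelAct x ∘ₗ W.subtype
    have hR : Function.Surjective R := fun u => by
      let f : V → H := fun v => if h : v ∈ V₀ then u ⟨v, h⟩ else 0
      refine ⟨⟨Γ.labelAct y f, f, rfl⟩, funext fun v => ?_⟩
      change Γ.labelAct x (Γ.labelAct y f) v = u v
      have h := (θ v v.2).labelAct_labelAct_toFun h1 hx hy f (m := 0) (k := 1) (by omega) (by simp)
      rw [(θ v v.2).map_one, hxy, _root_.map_one] at h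
      refine h.trans ?_
      simp [f, (θ v v.2).map_one]
    have := Module.length_le_of_surjective R hR
    rwa [hpi, Fintype.card_coe] at this
  -- The operator `1 - y x`, read at `V₂`, vanishes on `W` and so descends to the quotient. Its
  -- value at a vertex depends only on the 2-ball, and the possible values form the nonzero module
  -- `I`.
  · let e : (V → H) →ₗ[D] (V₂ → H) :=
      LinearMap.funLeft D H (Subtype.val : V₂ → V) ∘ₗ (LinearMap.id - Γ.labelAct y ∘ₗ Γ.labelAct x)
    have heW : W ≤ LinearMap.ker e := by
      rintro _ ⟨f, rfl⟩
      refine LinearMap.mem_ker.2 (funext fun v => ?_)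
      change Γ.labelAct y f v - Γ.labelAct y (Γ.labelAct x (Γ.labelAct y f)) v = 0
      rw [(θ v (hV v.2)).labelAct_labelAct_labelAct h1 hx hy hxy hr, sub_self]
    let ev : (G → H) →ₗ[D] H := LinearMap.proj 1 ∘ₗ convAct D H G (1 - y * x)
    have hev_apply (F : G → H) : ev F = F 1 - convAct D H G (y * x) F 1 := by
      simp [ev]
    have hev (F F' : G → H) (h : ∀ k ∈ B ^ 2, F k = F' k) : ev F = ev F' := by
      rw [hev_apply, hev_apply, h 1 (Set.one_mem_pow h1), map_mul]
      congr 1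
      refine convAct_congr fun b hb => convAct_congr fun c hc => h _ ?_
      rw [one_mul, pow_two]
      exact Set.mul_mem_mul (hy hb) (hx hc)
    have he (f : V → H) (v : V₂) : e f v = ev (f ∘ (θ v (hV v.2)).toFun) := by
      have h := (θ v (hV v.2)).labelAct_labelAct_toFun h1 hy hx f (m := 0) (k := 1) (by omega)
        (by simp)
      rw [(θ v (hV v.2)).map_one] at h
      rw [hev_apply, Function.comp_apply, (θ v (hV v.2)).map_one, ← h]
      rfl
    let I := LinearMap.range ev
    have hI : 1 ≤ Module.length D I := by
      obtain ⟨F, hF⟩ := exists_convAct_one_ne_zero (sub_ne_zero.2 hyx.symm)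
      have : Nontrivial I := ⟨⟨ev F, F, rfl⟩, 0, fun h => hF (congrArg Subtype.val h)⟩
      exact Order.one_le_iff_pos.2 Module.length_pos
    let φ : (V₂ → I) →ₗ[D] (V₂ → H) := LinearMap.pi fun v => I.subtype ∘ₗ LinearMap.proj v
    have hφ : Function.Injective φ := fun t t' h =>
      funext fun v => Subtype.ext (congrFun h v)
    have hrange : LinearMap.range φ ≤ LinearMap.range (W.liftQ e heW) := by
      rintro _ ⟨t, rfl⟩
      choose F hF using fun v => (t v).2
      -- Disjointness of the 2-balls lets the local functions `F v` be glued, with value zero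
      -- elsewhere; hence all of `V₂ → I` is attained.
      let f (w : V) : H := if h : ∃ (v : V₂) (k : G), k ∈ B ^ 2 ∧ (θ v (hV v.2)).toFun k = w then
        F h.choose h.choose_spec.choose else 0
      have hf (v : V₂) (k : G) (hk : k ∈ B ^ 2) : f ((θ v (hV v.2)).toFun k) = F v k := by
        have h : ∃ (v' : V₂) (k' : G), k' ∈ B ^ 2 ∧
            (θ v' (hV v'.2)).toFun k' = (θ v (hV v.2)).toFun k := ⟨v, k, hk, rfl⟩
        have huniq (v' : V₂) (k' : G) (hk' : k' ∈ B ^ 2)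
            (hθ : (θ v' (hV v'.2)).toFun k' = (θ v (hV v.2)).toFun k) : F v' k' = F v k := by
          obtain rfl : v' = v := Subtype.ext (hdisj _ v'.2 _ v.2 _ hk' _ hk hθ)
          rw [(θ v' (hV v'.2)).injOn (Set.pow_subset_pow_right h1 hr.le hk')
            (Set.pow_subset_pow_right h1 hr.le hk) hθ]
        exact (dif_pos h).trans
          (huniq _ _ h.choose_spec.choose_spec.1 h.choose_spec.choose_spec.2)
      refine ⟨W.mkQ f, funext fun v => ?_⟩
      change e f v = t v
      rw [he, ← hF v]
      exact hev _ _ fun k hk => hf v k hk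
    calc (V₂.card : ℕ∞) = V₂.card * 1 := (mul_one _).symm
      _ ≤ V₂.card * Module.length D I := by gcongr
      _ = Module.length D (V₂ → I) := by simp [Module.length_pi_of_fintype]
      _ ≤ Module.length D (LinearMap.range (W.liftQ e heW)) :=
        Module.length_le_of_injective (φ.codRestrict _ fun t => hrange ⟨t, rfl⟩)
          fun t t' h => hφ (congrArg Subtype.val h)
      _ ≤ Module.length D ((V → H) ⧸ W) :=
        Module.length_le_of_surjective (W.liftQ e heW).rangeRestrict
          (W.liftQ e heW).surjective_rangeRestrict

end LabeledDigraph

/-! ### Sofic groups: coefficients acting on a module of finite length. -/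

section Sofic

open scoped Pointwise

open LabeledDigraph

/-- A maximal family of vertices with pairwise disjoint `2`-neighborhoods contains a fixed
proportion of the vertices with a chart. -/
theorem LabeledDigraph.exists_subset_card_le {G : Type*} [Group G] {B : Set G} (hB : B.Finite)
    (h1 : 1 ∈ B) (hinv : ∀ b ∈ B, b⁻¹ ∈ B) {V : Type*} {Γ : LabeledDigraph B V} (V₀ : Finset V)
    (θ : ∀ v ∈ V₀, Chart Γ 4 v) :
    ∃ (V₂ : Finset V) (hV : V₂ ⊆ V₀), V₀.card ≤ V₂.card * (B ^ 4).ncard ∧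
      ∀ v (hv : v ∈ V₂) v' (hv' : v' ∈ V₂), ∀ k ∈ B ^ 2, ∀ k' ∈ B ^ 2,
        (θ v (hV hv)).toFun k = (θ v' (hV hv')).toFun k' → v = v' := by
  classical
  let P (S : Finset V) : Prop := ∀ v ∈ S, ∀ v' ∈ S, ∀ (hv : v ∈ V₀) (hv' : v' ∈ V₀),
    ∀ k ∈ B ^ 2, ∀ k' ∈ B ^ 2, (θ v hv).toFun k = (θ v' hv').toFun k' → v = v'
  obtain ⟨V₂, hV₂, hmax⟩ := (V₀.powerset.filter P).exists_maximal
    ⟨∅, Finset.mem_filter.2 ⟨Finset.empty_mem_powerset _, by simp [P]⟩⟩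
  obtain ⟨hV, hP⟩ := Finset.mem_filter.1 hV₂
  rw [Finset.mem_powerset] at hV
  refine ⟨V₂, hV, ?_, fun v hv v' hv' => hP v hv v' hv' (hV hv) (hV hv')⟩
  -- By maximality the 2-ball of any `u` in `V₀` meets that of some `v` in `V₂`. As `B` is
  -- symmetric, one can walk back to `u`, which thus lies in the 4-ball of `v`.
  have hcover : V₀ ⊆ V₂.attach.biUnion fun v =>
      (finite_pow hB 4).toFinset.image (θ v (hV v.2)).toFun := by
    intro u hu
    by_contra hcon
    have hu' (v : V) (hv : v ∈ V₂) (j : G) (hj : j ∈ B ^ 4) : (θ v (hV hv)).toFun j ≠ u :=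
      fun h => hcon (Finset.mem_biUnion.2 ⟨⟨v, hv⟩, Finset.mem_attach _ _,
        Finset.mem_image.2 ⟨j, by simpa using hj, h⟩⟩)
    have hmeet (v : V) (hv : v ∈ V₂) (k : G) (hk : k ∈ B ^ 2) (k' : G) (hk' : k' ∈ B ^ 2)
        (h : (θ v (hV hv)).toFun k = (θ u hu).toFun k') : False := by
      obtain ⟨j, hj, h'⟩ := (θ v (hV hv)).exists_toFun_eq_of_toFun_eq h1 hinv (n := 2) rfl
        (θ u hu) hk hk' h
      exact hu' v hv j hj h'
    have hins : insert u V₂ ∈ V₀.powerset.filter P := by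
      refine Finset.mem_filter.2 ⟨Finset.mem_powerset.2 (Finset.insert_subset hu hV), ?_⟩
      intro v hv v' hv' hv₀ hv₀' k hk k' hk' h
      rcases Finset.mem_insert.1 hv with rfl | hv₁ <;>
        rcases Finset.mem_insert.1 hv' with rfl | hv₁'
      · rfl
      · exact (hmeet v' hv₁' k' hk' k hk h.symm).elim
      · exact (hmeet v hv₁ k hk k' hk' h).elim
      · exact hP v hv₁ v' hv₁' hv₀ hv₀' k hk k' hk' h
    have huV : u ∈ V₂ := hmax hins (Finset.subset_insert u V₂) (Finset.mem_insert_self u V₂)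
    exact hu' u huV 1 (Set.one_mem_pow h1) (θ u (hV huV)).map_one
  refine (Finset.card_le_card hcover).trans (Finset.card_biUnion_le.trans ?_)
  rw [← Finset.card_attach (s := V₂), ← smul_eq_mul]
  refine Finset.sum_le_card_nsmul _ _ _ fun v _ => Finset.card_image_le.trans ?_
  rw [Set.ncard_eq_toFinset_card _ (finite_pow hB 4)]

theorem exists_finite_symmetric_generating {G : Type*} [Group G] [Group.FG G] (S : Finset G) :
    ∃ B : Set G, B.Finite ∧ 1 ∈ B ∧ (∀ b ∈ B, b⁻¹ ∈ B) ∧ Subgroup.closure B = ⊤ ∧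
      (S : Set G) ⊆ B := by
  obtain ⟨T, hT, hTfin⟩ := Group.fg_iff.1 (inferInstance : Group.FG G)
  have hfin : (T ∪ S ∪ {1}).Finite := (hTfin.union S.finite_toSet).union (Set.finite_singleton 1)
  refine ⟨(T ∪ S ∪ {1}) ∪ (T ∪ S ∪ {1})⁻¹, hfin.union hfin.inv, by simp, ?_, ?_, ?_⟩
  · rintro b (hb | hb)
    · exact Or.inr (Set.inv_mem_inv.2 hb)
    · exact Or.inl hb
  · rw [eq_top_iff, ← hT]
    exact Subgroup.closure_mono fun t ht => Or.inl (Or.inl (Or.inl ht))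
  · exact fun s hs => Or.inl (Or.inl (Or.inr hs))

/-- The group ring of a sofic group over the endomorphism ring of a module of finite length is
directly finite. -/
theorem isDedekindFiniteMonoid_monoidAlgebra_end (D H : Type*) {G : Type*} [Ring D]
    [AddCommGroup H] [Module D H] [Group G] [Group.FG G] (hG : IsSoficOfFG G)
    (hH : Module.length D H ≠ ⊤) :
    IsDedekindFiniteMonoid (MonoidAlgebra (Module.End D H) G) := by
  classical
  refine ⟨fun {x y} hxy => by_contra fun hyx => ?_⟩
  obtain ⟨B, hB, h1, hinv, hgen, hsupp⟩ :=
    exists_finite_symmetric_generating (x.coeff.support ∪ y.coeff.support)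
  rw [Finset.coe_union, Set.union_subset_iff] at hsupp
  obtain ⟨l, hl⟩ := ENat.ne_top_iff_exists.1 hH
  let C := (B ^ 4).ncard
  have hpos : (0 : ℝ) < C * l + 2 := by positivity
  -- With this `ε`, the bounds `h₂` and `h₃` below would give `(C * l + 1) ^ 2 ≤ C * l * (C * l +
  -- 2)`, which is false by one.
  obtain ⟨V, _, _, Γ, V₀, hcard, hiso⟩ := hG B hB hinv hgen (1 / (C * l + 2)) (by positivity)
    (by rw [div_lt_one hpos]; linarith [mul_nonneg C.cast_nonneg (α := ℝ) l.cast_nonneg]) 4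
  have θ : ∀ v ∈ V₀, Chart Γ 4 v := fun v hv => (nonempty_chart hB h1 (hiso v hv).some).some
  obtain ⟨V₂, hV, hV₂, hdisj⟩ := exists_subset_card_le hB h1 hinv V₀ θ
  have hlen := card_mul_length_add_card_le h1 hsupp.1 hsupp.2 hxy hyx (by norm_num) V₀ V₂ hV θ hdisj
  rw [← hl] at hlen
  have hlen' : V₀.card * l + V₂.card ≤ Fintype.card V * l := by exact_mod_cast hlen
  have h₁ : V₀.card * (C * l + 1) ≤ Fintype.card V * (C * l) := by
    calc V₀.card * (C * l + 1) = C * (V₀.card * l) + V₀.card := by ring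
      _ ≤ C * (V₀.card * l) + V₂.card * C := by gcongr
      _ = C * (V₀.card * l + V₂.card) := by ring
      _ ≤ C * (Fintype.card V * l) := by gcongr
      _ = _ := by ring
  have h₂ : (V₀.card : ℝ) * (C * l + 1) ≤ Fintype.card V * (C * l) := by exact_mod_cast h₁
  have h₃ : (C * l + 1 : ℝ) * Fintype.card V ≤ V₀.card * (C * l + 2) := by
    have h₄ : (1 - 1 / (C * l + 2) : ℝ) = (C * l + 1) / (C * l + 2) := by
      field_simp
      ring
    rwa [h₄, div_mul_eq_mul_div, div_le_iff₀ hpos] at hcard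
  have h₄ : (0 : ℝ) < Fintype.card V := by exact_mod_cast Fintype.card_pos
  have h₅ : (0 : ℝ) ≤ C * l := by positivity
  nlinarith [mul_le_mul_of_nonneg_right h₃ (by linarith : (0 : ℝ) ≤ C * l + 1),
    mul_le_mul_of_nonneg_right h₂ hpos.le]

end Sofic

/-! ### Noetherian coefficients and the conclusion. -/

section Main

variable {𝒢 : Type u} [Category.{v} 𝒢] [Abelian 𝒢]

/-- The action of the endomorphisms of `N` on `A ⟶ E`, for a fully invariant subobject `A`
of `N`. -/
noncomputable def restrictPrecomp (E : 𝒢) {N : 𝒢} (A : Subobject N)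
    (hA : ∀ s : N ⟶ N, A.Factors (A.arrow ≫ s)) :
    (End N)ᵐᵒᵖ →+* Module.End (End E) ((A : 𝒢) ⟶ E) where
  toFun s := precompLinear E (A.factorThru _ (hA s.unop))
  map_one' := LinearMap.ext fun h => by
    have : A.factorThru _ (hA (𝟙 N)) = 𝟙 _ := by
      rw [← cancel_mono A.arrow]; simp
    exact (congrArg (· ≫ h) this).trans (Category.id_comp h)
  map_mul' s t := LinearMap.ext fun h => by
    have : A.factorThru _ (hA (s.unop ≫ t.unop)) =
        A.factorThru _ (hA s.unop) ≫ A.factorThru _ (hA t.unop) := by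
      rw [← cancel_mono A.arrow]; simp
    exact (congrArg (· ≫ h) this).trans (Category.assoc _ _ _)
  map_zero' := LinearMap.ext fun h => by
    have : A.factorThru _ (hA (0 : N ⟶ N)) = 0 := by
      rw [← cancel_mono A.arrow]; simp
    exact (congrArg (· ≫ h) this).trans zero_comp
  map_add' s t := LinearMap.ext fun h => by
    have : A.factorThru _ (hA (s.unop + t.unop)) =
        A.factorThru _ (hA s.unop) + A.factorThru _ (hA t.unop) := by
      rw [← cancel_mono A.arrow, Preadditive.add_comp]
      simp only [Subobject.factorThru_arrow]
      exact Preadditive.comp_add _ _ _ _ _ _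
    exact (congrArg (· ≫ h) this).trans (Preadditive.add_comp _ _ _ _ _ _)

theorem restrictPrecomp_arrow_comp (E : 𝒢) {N : 𝒢} (A : Subobject N)
    (hA : ∀ s : N ⟶ N, A.Factors (A.arrow ≫ s)) (s : (End N)ᵐᵒᵖ) (h : N ⟶ E) :
    restrictPrecomp E A hA s (A.arrow ≫ h) = A.arrow ≫ s.unop ≫ h := by
  change A.factorThru _ (hA s.unop) ≫ A.arrow ≫ h = _
  rw [Subobject.factorThru_arrow_assoc, Category.assoc]

variable [IsGrothendieckAbelian.{w} 𝒢]

/-- The group ring of a sofic group over the endomorphism ring of a Noetherian object is directly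
finite. -/
theorem isDedekindFiniteMonoid_monoidAlgebra_end_of_isNoetherianObject {G : Type*} [Group G]
    [Group.FG G] (hG : IsSoficOfFG G) (N : 𝒢) [IsNoetherianObject N] :
    IsDedekindFiniteMonoid (MonoidAlgebra (End N)ᵐᵒᵖ G) := by
  refine ⟨fun {x y} hxy => by_contra fun hyx => ?_⟩
  let e := 1 - y * x
  have hidem : e * e = e := by
    have : y * x * (y * x) = y * x := by rw [mul_assoc, ← mul_assoc x, hxy, one_mul]
    simp only [e, mul_sub, sub_mul, mul_one, one_mul, this]
    abel
  obtain ⟨g₀, hg₀⟩ : ∃ g, e.coeff g ≠ 0 := by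
    by_contra! h
    exact hyx (sub_eq_zero.1 (MonoidAlgebra.ext (Finsupp.ext h) : e = 0)).symm
  obtain ⟨E, A, hE, hlen, hA, g, h, hgh⟩ := exists_subobject_homLength_ne_top_comp_ne_zero N
    (fun g => ((e.coeff g).unop : N ⟶ N)) g₀
    (fun h => hg₀ (MulOpposite.unop_injective h)) fun X f hf g => by
      -- Since `e * e = e`, each coefficient is a sum of products of two coefficients; this is the
      -- idempotent-like hypothesis of the detection theorem.
      have h₁ : ((e.coeff g).unop : N ⟶ N) =
          ∑ k ∈ e.coeff.support, (e.coeff k).unop ≫ (e.coeff (k⁻¹ * g)).unop := by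
        conv_lhs => rw [← hidem, MonoidAlgebra.coeff_mul_apply_left, Finsupp.sum]
        exact Finset.unop_sum _ _
      rw [h₁, Preadditive.comp_sum]
      exact Finset.sum_eq_zero fun k _ => hf _ _
  have := isDedekindFiniteMonoid_monoidAlgebra_end (End E) ((A : 𝒢) ⟶ E) hG hlen
  let ρ := MonoidAlgebra.mapRingHom G (restrictPrecomp E A hA)
  have hρ : ρ y * ρ x = 1 := mul_eq_one_symm (by rw [← map_mul, hxy, map_one])
  have hρe : ρ e = 0 := by
    rw [map_sub, map_one, map_mul, hρ, sub_self]
  have hρg : restrictPrecomp E A hA (e.coeff g) = 0 := by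
    rw [← MonoidAlgebra.coeff_mapRingHom]
    exact congrArg (fun z => z.coeff g) hρe
  apply hgh
  rw [← restrictPrecomp_arrow_comp E A hA, hρg]
  rfl

end Main

theorem mainTheorem4 {𝒢 : Type u} [Category.{v} 𝒢] [Abelian 𝒢] [IsGrothendieckAbelian.{w} 𝒢]
    {G : Type w} [Group G] [Group.FG G] (hG : IsSoficOfFG G)
    (N : 𝒢) [IsNoetherianObject N] :
    IsDedekindFiniteMonoid (End ((extendTrivial G 𝒢).obj N)) := by
  obtain ⟨Φ, hinj, hone, hmul⟩ := exists_monoidAlgebra_of_extendTrivial (G := G) N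
  have := isDedekindFiniteMonoid_monoidAlgebra_end_of_isNoetherianObject hG N
  refine ⟨fun {x y} hxy => hinj ?_⟩
  rw [hmul, hone]
  exact mul_eq_one_symm (by rw [← hmul, hxy, hone])
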